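/- **Theorem.** Fix an o-minimal structure over $\mathbb{R}$. Let $X\subset\mathbb{R}^n$ be a definable cellular complex, i.e. a finite CW complex all of whose open cells are definable, and let $f\colon X\to X$ be a cellular homeomorphism. Let $X=X_1\sqcup\dots\sqcup X_k$ be a partition into definable, locally compact, $f$-invariant ($f(X_j)=X_j$) incomplete subcomplexes (unions of open cells), with inclusions $i_j\colon X_j\to X$. Call a sheaf $\mathcal{F}$ of real vector spaces on $X$ with finite-dimensional stalks *$f$-$c$-constructible* (for this partition) if its restriction to each connected component of each $X_j$ is a constant sheaf, and put $$\mathcal{F}'=\bigoplus_{j=1}^k (i_j)_!\,i_j^*\mathcal{F},$$ where $(i_j)_!$ is extension by zero: $((i_j)_!\mathcal{G})(U)$ is the space of sections of $\mathcal{G}$ over $U\cap X_j$ whose support is closed in $U$. 1. Let $\mathcal{F}$ be $f$-$c$-constructible and suppose that $f$ respects the constant components of $\mathcal{F}$: each $X_j$ is the disjoint union of finitely many relatively open subsets $W$ with $f(W)=W$ on each of which $\mathcal{F}$ is constant (for example, the connected components of $X_j$, if $f$ maps each of them onto itself). Then $f^*(\mathcal{F}')\cong\mathcal{F}'$. 2.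 If $f$ maps each connected component of each $X_j$ onto itself, then the isomorphism can be chosen naturally in $\mathcal{F}$: on the full subcategory of sheaves that are $f$-$c$-constructible for the given partition, the functors $\mathcal{F}\mapsto f^*(\mathcal{F}')$ and $\mathcal{F}\mapsto\mathcal{F}'$ are naturally isomorphic. -/

import Mathlib

open CategoryTheory CategoryTheory.Limits TopologicalSpace Opposite

noncomputable section

/-! ## O-minimal structures over the real field -/

/-- An o-minimal structure over `ℝ`: for every `n` an algebra of subsets of `ℝⁿ` (the definable
sets), closed under cartesian products and coordinate projections, containing the order relation
and all algebraic sets, and such that the definable subsets of the line are exactly the finite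
unions of points and open intervals (bounded or not). -/
structure OMinimalStructure where
  IsDefinable : ∀ {n : ℕ}, Set (Fin n → ℝ) → Prop
  empty : ∀ n : ℕ, IsDefinable (∅ : Set (Fin n → ℝ))
  compl : ∀ {n : ℕ} {A : Set (Fin n → ℝ)}, IsDefinable A → IsDefinable Aᶜ
  union : ∀ {n : ℕ} {A B : Set (Fin n → ℝ)},
    IsDefinable A → IsDefinable B → IsDefinable (A ∪ B)
  prod : ∀ {m n : ℕ} {A : Set (Fin m → ℝ)} {B : Set (Fin n → ℝ)},
    IsDefinable A → IsDefinable B →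
      IsDefinable {z : Fin (m + n) → ℝ |
        (fun i => z (Fin.castAdd n i)) ∈ A ∧ (fun i => z (Fin.natAdd m i)) ∈ B}
  proj : ∀ {n : ℕ} {A : Set (Fin (n + 1) → ℝ)}, IsDefinable A →
    IsDefinable ((fun (z : Fin (n + 1) → ℝ) (i : Fin n) => z i.castSucc) '' A)
  lt : IsDefinable {z : Fin 2 → ℝ | z 0 < z 1}
  line : ∀ A : Set (Fin 1 → ℝ), IsDefinable A ↔
    ∃ (p : Finset ℝ) (I : Finset (EReal × EReal)),
      A = {z | z 0 ∈ p ∨ ∃ ab ∈ I, ab.1 < (z 0 : EReal) ∧ (z 0 : EReal) < ab.2}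
  algebraic : ∀ {n : ℕ} (s : Set (MvPolynomial (Fin n) ℝ)),
    IsDefinable {z : Fin n → ℝ | ∀ q ∈ s, MvPolynomial.eval z q = 0}

/-! ## Definable cellular complexes -/

section Cellular

variable {n : ℕ} (S : OMinimalStructure) (X : Set (Fin n → ℝ)) [Topology.CWComplex X]

/-- A definable cellular complex: a finite CW complex in some `ℝⁿ` all of whose open cells
are definable. -/
structure IsDefinableCellularComplex : Prop where
  finite : Topology.CWComplex.Finite X
  definable_openCell : ∀ (m : ℕ) (e : Topology.CWComplex.cell X m),
    S.IsDefinable (Topology.RelCWComplex.openCell (C := X) m e)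

/-- A self-homeomorphism is cellular if it maps every skeleton into itself. -/
def IsCellularHomeomorph (f : X ≃ₜ X) : Prop :=
  ∀ (m : ℕ) (x : X),
    (x : Fin n → ℝ) ∈ Topology.RelCWComplex.skeleton X (m : ℕ∞) →
      (f x : Fin n → ℝ) ∈ Topology.RelCWComplex.skeleton X (m : ℕ∞)

/-- An incomplete subcomplex: a (not necessarily closed) union of open cells. -/
def IsIncompleteSubcomplex (U : Set X) : Prop :=
  ∃ I : ∀ m : ℕ, Set (Topology.CWComplex.cell X m),
    (Subtype.val '' U : Set (Fin n → ℝ)) =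
      ⋃ (m : ℕ) (e ∈ I m), Topology.RelCWComplex.openCell (C := X) m e

/-- A finite partition of `X` into definable, locally compact, `f`-invariant incomplete
subcomplexes. -/
structure IsInvariantPartition (f : X ≃ₜ X) {k : ℕ} (P : Fin k → Set X) : Prop where
  disjoint : Pairwise (fun i j => Disjoint (P i) (P j))
  cover : ⋃ j, P j = Set.univ
  incomplete : ∀ j, IsIncompleteSubcomplex X (P j)
  definable : ∀ j, S.IsDefinable (Subtype.val '' P j : Set (Fin n → ℝ))
  locallyCompact : ∀ j, LocallyCompactSpace (P j)
  invariant : ∀ j, f '' P j = P j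

end Cellular

/-! ## Sheaves of real vector spaces -/

/-- Sheaves of real vector spaces on a topological space. -/
abbrev VSheaf (X : TopCat.{0}) := TopCat.Sheaf (ModuleCat.{0} ℝ) X

/-- The inverse image functor `g^*`. -/
abbrev VSheaf.inverseImage {X Y : TopCat.{0}} (g : X ⟶ Y) : VSheaf Y ⥤ VSheaf X :=
  TopCat.Sheaf.pullback (ModuleCat.{0} ℝ) g

/-- The inclusion of a subspace. -/
abbrev subspaceIncl {X : TopCat.{0}} (A : Set X) : TopCat.of A ⟶ X :=
  TopCat.ofHom ⟨Subtype.val, continuous_subtype_val⟩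

/-- The restriction `F|_A = i^* F` to a subspace `i : A → X`. -/
abbrev VSheaf.restrict {X : TopCat.{0}} (A : Set X) : VSheaf X ⥤ VSheaf (TopCat.of A) :=
  VSheaf.inverseImage (subspaceIncl A)

/-- `F` is constant on the subspace `A`: its restriction to `A` is isomorphic to the constant
sheaf of some vector space. -/
def VSheaf.IsConstantOn {X : TopCat.{0}} (F : VSheaf X) (A : Set X) : Prop :=
  Sheaf.IsConstant (Opens.grothendieckTopology (TopCat.of A)) ((VSheaf.restrict A).obj F)

/-! ### Extension by zero -/

namespace ExtensionByZero

variable {X : TopCat.{0}} {A : Set X}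

/-- `U ∩ A`, as an open subset of `A`. -/
abbrev trace (A : Set X) (U : Opens X) : Opens (TopCat.of A) :=
  (Opens.map (subspaceIncl A)).obj U

/-- Restriction of sections from `U ∩ A` to `V ∩ A`, for `V ⊆ U`. -/
abbrev res (G : VSheaf (TopCat.of A)) {U V : Opens X} (h : V ≤ U) :
    G.presheaf.obj (op (trace A U)) ⟶ G.presheaf.obj (op (trace A V)) :=
  G.presheaf.map ((Opens.map (subspaceIncl A)).map (homOfLE h)).op

/-- The support in `U` of a section over `U ∩ A`: the points of `U ∩ A` with nonzero germ. -/
def support (G : VSheaf (TopCat.of A)) (U : Opens X)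
    (s : G.presheaf.obj (op (trace A U))) : Set U :=
  {x | ∃ h : (x : X) ∈ A,
    G.presheaf.germ (trace A U) (⟨x, h⟩ : A) x.2 s ≠ 0}

theorem mem_support_iff (G : VSheaf (TopCat.of A)) (U : Opens X)
    (s : G.presheaf.obj (op (trace A U))) (x : U) :
    x ∉ support G U s ↔ ∀ h : (x : X) ∈ A,
      G.presheaf.germ (trace A U) (⟨x, h⟩ : A) x.2 s = 0 := by
  simp [support]

theorem isClosed_support_iff (G : VSheaf (TopCat.of A)) (U : Opens X)
    (s : G.presheaf.obj (op (trace A U))) :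
    IsClosed (support G U s) ↔
      ∀ x ∈ U, x ∉ A → ∃ (V : Opens X) (h : V ≤ U), x ∈ V ∧ res G h s = 0 := by
  constructor
  · intro hs x hxU hxA
    obtain ⟨V, hV, hVe⟩ := isOpen_induced_iff.1 hs.isOpen_compl
    refine ⟨⟨V, hV⟩ ⊓ U, inf_le_right, ⟨?_, hxU⟩, ?_⟩
    · have : (⟨x, hxU⟩ : U) ∈ (Subtype.val ⁻¹' V : Set U) := by
        rw [hVe]
        exact fun ⟨h, _⟩ => hxA h
      exact this
    · apply TopCat.Presheaf.section_ext G
      intro y hy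
      rw [TopCat.Presheaf.germ_res_apply, map_zero]
      have hyU : (⟨y.1, hy.2⟩ : U) ∈ (support G U s)ᶜ := by
        rw [← hVe]
        exact hy.1
      exact (mem_support_iff G U s _).1 hyU y.2
  · intro H
    rw [← isOpen_compl_iff, isOpen_iff_mem_nhds]
    intro x hx
    suffices ∃ (V : Opens X) (h : V ≤ U), (x : X) ∈ V ∧ res G h s = 0 by
      obtain ⟨V, h, hxV, hV⟩ := this
      refine Filter.mem_of_superset
        ((V.isOpen.preimage continuous_subtype_val).mem_nhds hxV) ?_
      intro y hy
      rw [Set.mem_compl_iff, mem_support_iff]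
      intro hyA
      rw [← TopCat.Presheaf.germ_res_apply G.presheaf
        ((Opens.map (subspaceIncl A)).map (homOfLE h)) (⟨y, hyA⟩ : A) hy s]
      erw [hV]
      exact map_zero _
    by_cases hxA : (x : X) ∈ A
    · have h0 := (mem_support_iff G U s x).1 hx hxA
      rw [← map_zero (G.presheaf.germ (trace A U) (⟨x, hxA⟩ : A) x.2).hom] at h0
      obtain ⟨W, hxW, i, i', hW⟩ := G.presheaf.germ_eq _ _ _ _ _ h0
      obtain ⟨V, hV, hVW⟩ := isOpen_induced_iff.1 W.isOpen
      have hle : trace A (⟨V, hV⟩ ⊓ U) ≤ W := by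
        intro y hy
        have : y ∈ (Subtype.val ⁻¹' V : Set A) := hy.1
        rw [hVW] at this
        exact this
      refine ⟨⟨V, hV⟩ ⊓ U, inf_le_right, ⟨?_, x.2⟩, ?_⟩
      · have : (⟨x, hxA⟩ : A) ∈ (Subtype.val ⁻¹' V : Set A) := by
          rw [hVW]
          exact hxW
        exact this
      · have e := congrArg (G.presheaf.map (homOfLE hle).op) hW
        rw [map_zero, map_zero, ← ConcreteCategory.comp_apply, ← G.presheaf.map_comp] at e
        exact e
    · exact H x x.2 hxA

/-- The sections of the extension by zero over `U`: the sections over `U ∩ A` whose support is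
closed in `U`. -/
def sections (G : VSheaf (TopCat.of A)) (U : Opens X) :
    Submodule ℝ (G.presheaf.obj (op (trace A U))) where
  carrier := {s | IsClosed (support G U s)}
  zero_mem' := by
    rw [Set.mem_ofPred_eq, isClosed_support_iff]
    exact fun x hx _ => ⟨U, le_rfl, hx, map_zero _⟩
  add_mem' := by
    intro s t hs ht
    rw [Set.mem_ofPred_eq, isClosed_support_iff] at *
    intro x hx hxA
    obtain ⟨V, hV, hxV, hsV⟩ := hs x hx hxA
    obtain ⟨W, hW, hxW, htW⟩ := ht x hx hxA
    refine ⟨V ⊓ W, inf_le_left.trans hV, ⟨hxV, hxW⟩, ?_⟩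
    have e₁ : res G (inf_le_left.trans hV : V ⊓ W ≤ U) s = 0 := by
      have e := congrArg (res G (inf_le_left : V ⊓ W ≤ V)) hsV
      rw [map_zero, ← ConcreteCategory.comp_apply, ← G.presheaf.map_comp] at e
      exact e
    have e₂ : res G (inf_le_left.trans hV : V ⊓ W ≤ U) t = 0 := by
      have e := congrArg (res G (inf_le_right : V ⊓ W ≤ W)) htW
      rw [map_zero, ← ConcreteCategory.comp_apply, ← G.presheaf.map_comp] at e
      exact e
    rw [map_add, e₁, e₂, add_zero]
  smul_mem' := by
    intro c s hs
    rw [Set.mem_ofPred_eq, isClosed_support_iff] at *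
    intro x hx hxA
    obtain ⟨V, hV, hxV, hsV⟩ := hs x hx hxA
    exact ⟨V, hV, hxV, by rw [map_smul, hsV, smul_zero]⟩

theorem mem_sections_iff (G : VSheaf (TopCat.of A)) (U : Opens X)
    (s : G.presheaf.obj (op (trace A U))) :
    s ∈ sections G U ↔
      ∀ x ∈ U, x ∉ A → ∃ (V : Opens X) (h : V ≤ U), x ∈ V ∧ res G h s = 0 :=
  isClosed_support_iff G U s

theorem res_mem (G : VSheaf (TopCat.of A)) {U V : Opens X} (h : V ≤ U)
    {s : G.presheaf.obj (op (trace A U))} (hs : s ∈ sections G U) :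
    res G h s ∈ sections G V := by
  rw [mem_sections_iff] at *
  intro x hx hxA
  obtain ⟨W, hW, hxW, hsW⟩ := hs x (h hx) hxA
  refine ⟨W ⊓ V, inf_le_right, ⟨hxW, hx⟩, ?_⟩
  have e := congrArg (res G (inf_le_left : W ⊓ V ≤ W)) hsW
  rw [map_zero, ← ConcreteCategory.comp_apply, ← G.presheaf.map_comp] at e
  rw [← ConcreteCategory.comp_apply, ← G.presheaf.map_comp]
  exact e

theorem app_mem {G H : VSheaf (TopCat.of A)} (φ : G ⟶ H) (U : Opens X)
    {s : G.presheaf.obj (op (trace A U))} (hs : s ∈ sections G U) :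
    φ.1.app (op (trace A U)) s ∈ sections H U := by
  rw [mem_sections_iff] at *
  intro x hx hxA
  obtain ⟨V, hV, hxV, hsV⟩ := hs x hx hxA
  refine ⟨V, hV, hxV, ?_⟩
  have e := congrArg (φ.1.app (op (trace A V))) hsV
  rw [map_zero] at e
  rw [← e]
  exact (NatTrans.naturality_apply φ.1 _ s).symm

/-- The presheaf `U ↦ {s ∈ G(U ∩ A) | supp s is closed in U}`. -/
def presheaf (G : VSheaf (TopCat.of A)) : TopCat.Presheaf (ModuleCat.{0} ℝ) X where
  obj U := ModuleCat.of ℝ (sections G U.unop)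
  map {U V} i := ModuleCat.ofHom
    ((res G i.unop.le).hom.restrict (p := sections G U.unop) (q := sections G V.unop)
      fun _ hs => res_mem G i.unop.le hs)
  map_id U := by
    ext s
    exact ConcreteCategory.congr_hom (G.presheaf.map_id (op (trace A U.unop))) s.1
  map_comp {U V W} i j := by
    ext s
    change res G _ s.1 = res G _ (res G _ s.1)
    rw [← ConcreteCategory.comp_apply, ← G.presheaf.map_comp]
    rfl

theorem presheaf_isSheaf (G : VSheaf (TopCat.of A)) : (presheaf G).IsSheaf := by
  rw [TopCat.Presheaf.isSheaf_iff_isSheafUniqueGluing]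
  intro ι U sf hsf
  obtain ⟨t, ht, huniq⟩ := TopCat.Sheaf.existsUnique_gluing' G (fun i => trace A (U i))
    (trace A (iSup U)) (fun i => (Opens.map (subspaceIncl A)).map (Opens.leSupr U i))
    (by
      intro x hx
      obtain ⟨i, hi⟩ := Opens.mem_iSup.1 (show (x : X) ∈ iSup U from hx)
      exact Opens.mem_iSup.2 ⟨i, hi⟩)
    (fun i => (sf i).1)
    (fun i j => congrArg Subtype.val (hsf i j))
  have htm : t ∈ sections G (iSup U) := by
    rw [mem_sections_iff]
    intro x hx hxA
    obtain ⟨i, hi⟩ := Opens.mem_iSup.1 hx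
    obtain ⟨V, hV, hxV, hsV⟩ := (mem_sections_iff G _ _).1 (sf i).2 x hi hxA
    refine ⟨V, hV.trans (le_iSup U i), hxV, ?_⟩
    rw [← ht i, ← ConcreteCategory.comp_apply, ← G.presheaf.map_comp] at hsV
    exact hsV
  refine ⟨⟨t, htm⟩, fun i => Subtype.ext (ht i), ?_⟩
  intro t' ht'
  exact Subtype.ext (huniq t'.1 fun i => congrArg Subtype.val (ht' i))

end ExtensionByZero

/-- The extension by zero `i_! : Sh(A) ⥤ Sh(X)` along the inclusion `i : A → X` of a locally closed
subspace: `(i_! G)(U)` consists of the sections of `G` over `U ∩ A` with support closed in `U`. -/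
def VSheaf.extensionByZero {X : TopCat.{0}} (A : Set X) : VSheaf (TopCat.of A) ⥤ VSheaf X where
  obj G := ⟨ExtensionByZero.presheaf G, ExtensionByZero.presheaf_isSheaf G⟩
  map {G H} φ := ⟨{
    app := fun U => ModuleCat.ofHom
      ((φ.1.app (op (ExtensionByZero.trace A U.unop))).hom.restrict
        (p := ExtensionByZero.sections G U.unop) (q := ExtensionByZero.sections H U.unop)
        fun _ hs => ExtensionByZero.app_mem φ U.unop hs)
    naturality := by
      intro U V i
      ext s
      apply Subtype.ext
      exact NatTrans.naturality_apply φ.1 _ s.1 }⟩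
  map_id G := by
    apply CategoryTheory.Sheaf.hom_ext
    rfl
  map_comp φ ψ := by
    apply CategoryTheory.Sheaf.hom_ext
    rfl

/-! ### Constructible sheaves and the associated sheaf -/

section Constructible

variable {X : TopCat.{0}} {k : ℕ}

/-- The sheaf `F` of real vector spaces has finite dimensional stalks and is constant on every
connected component of every member of the family `P`. -/
def VSheaf.IsCConstructible (P : Fin k → Set X) : ObjectProperty (VSheaf X) := fun F =>
  (∀ x : X, FiniteDimensional ℝ (F.presheaf.stalk x)) ∧
    ∀ (j : Fin k), ∀ x ∈ P j, F.IsConstantOn (connectedComponentIn (P j) x)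

/-- `f` respects the constant components of `F`: each `P j` is the disjoint union of finitely many
relatively open `f`-invariant subsets on each of which `F` is constant. -/
def VSheaf.RespectsConstantComponents (f : X ≃ₜ X) (P : Fin k → Set X) (F : VSheaf X) : Prop :=
  ∀ j : Fin k, ∃ (m : ℕ) (W : Fin m → Set X),
    Pairwise (fun a b => Disjoint (W a) (W b)) ∧ ⋃ a, W a = P j ∧
    ∀ a, IsOpen (Subtype.val ⁻¹' W a : Set (P j)) ∧ f '' W a = W a ∧ F.IsConstantOn (W a)

instance (X : TopCat.{0}) : HasFiniteBiproducts (VSheaf X) := Abelian.hasFiniteBiproducts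

/-- The functor sending `F` to its associated sheaf `F' = ⨁ j, (i_j)_! (i_j)^* F`, where `i_j` is
the inclusion of `P j`. -/
def VSheaf.associated (P : Fin k → Set X) : VSheaf X ⥤ VSheaf X where
  obj F := ⨁ fun j => (VSheaf.extensionByZero (P j)).obj ((VSheaf.restrict (P j)).obj F)
  map u := biproduct.map fun j =>
    (VSheaf.extensionByZero (P j)).map ((VSheaf.restrict (P j)).map u)
  map_id F := by
    ext
    simp
  map_comp u v := by
    ext
    simp

end Constructible

end

open CategoryTheory CategoryTheory.Limits TopologicalSpace Opposite

noncomputable section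

/-! Since `f` is a homeomorphism, `f^*` is the direct image along `f⁻¹` (`inverseImageHomeoIso`).
Direct images commute with finite direct sums and, because `f` preserves each `P j`, with extension
by zero (`extensionByZeroPushIso`). It therefore suffices to compare `G = F|_{P j}` with `g_* G`,
where `g` is the restriction of `f⁻¹` to `P j`.

The sheaves `G` and `g_* G` have the same global sections. Suppose that a space `M` of them
generates `G` locally, and that each member vanishes near `g x` exactly when it vanishes near `x`.
Then sending each member of `M` to itself respects all local relations, so it extends uniquely to an
isomorphism `G ≅ g_* G` (`LocalModel.iso`, `LocallyGenerates.localModel`).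

For the first claim, `M` consists of the sections that are constant, in a chosen trivialization, on
each invariant piece: such a section is zero on a piece as soon as one of its germs there is zero.
For the second claim the pieces are connected components, which are open because there are finitely
many of them. On a connected piece every section has this all-or-nothing property, so `M` can be the
space of all global sections. No choice enters, and the isomorphism is natural. -/

namespace VSheaf

/-! ### Sheaf morphisms determined by locally generating global sections. -/

variable {X : TopCat.{0}}

/-- Restriction of sections, as a linear map. -/
def rs (G : VSheaf X) {V U : Opens X} (h : V ≤ U) :
    G.presheaf.obj (op U) →ₗ[ℝ] G.presheaf.obj (op V) :=
  (G.presheaf.map (homOfLE h).op).hom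

@[simp]
theorem rs_rs (G : VSheaf X) {W V U : Opens X} (h : W ≤ V) (h' : V ≤ U)
    (s : G.presheaf.obj (op U)) : G.rs h (G.rs h' s) = G.rs (h.trans h') s := by
  change G.presheaf.map _ (G.presheaf.map _ s) = _
  rw [← ConcreteCategory.comp_apply, ← G.presheaf.map_comp]
  rfl

theorem app_rs {G H : VSheaf X} (u : G ⟶ H) {V U : Opens X} (h : V ≤ U)
    (s : G.presheaf.obj (op U)) :
    u.1.app (op V) (G.rs h s) = H.rs h (u.1.app (op U) s) :=
  NatTrans.naturality_apply u.1 (homOfLE h).op s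

theorem ext_of_locally (G : VSheaf X) {U : Opens X} {s t : G.presheaf.obj (op U)}
    (H : ∀ x ∈ U, ∃ (V : Opens X) (h : V ≤ U), x ∈ V ∧ G.rs h s = G.rs h t) : s = t := by
  choose V hV hx he using H
  exact TopCat.Sheaf.eq_of_locally_eq' G (fun x : U => V x.1 x.2) U
    (fun x => homOfLE (hV x.1 x.2)) (fun x hxU => Opens.mem_iSup.2 ⟨⟨x, hxU⟩, hx x hxU⟩) s t
    fun x => he x.1 x.2

theorem exists_glue (G : VSheaf X) {ι : Type} (V : ι → Opens X) (U : Opens X)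
    (hV : ∀ i, V i ≤ U) (hU : ∀ x ∈ U, ∃ i, x ∈ V i) (s : ∀ i, G.presheaf.obj (op (V i)))
    (hs : ∀ i j, G.rs (inf_le_left : V i ⊓ V j ≤ V i) (s i) =
      G.rs (inf_le_right : V i ⊓ V j ≤ V j) (s j)) :
    ∃ t : G.presheaf.obj (op U), ∀ i, G.rs (hV i) t = s i := by
  obtain ⟨t, ht, -⟩ := TopCat.Sheaf.existsUnique_gluing' G V U (fun i => homOfLE (hV i))
    (fun x hx => Opens.mem_iSup.2 (hU x hx)) s hs
  exact ⟨t, ht⟩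

/-- Two sheaves `G`, `H` together with families of global sections, indexed by the same vector
space `M`, which generate them locally and satisfy the same local relations. -/
structure LocalModel (G H : VSheaf X) {M : Type} [AddCommGroup M] [Module ℝ M]
    (φ : M →ₗ[ℝ] G.presheaf.obj (op ⊤)) (ψ : M →ₗ[ℝ] H.presheaf.obj (op ⊤)) : Prop where
  left : ∀ (U : Opens X) (s : G.presheaf.obj (op U)), ∀ x ∈ U, ∃ (V : Opens X) (h : V ≤ U),
    x ∈ V ∧ ∃ m, G.rs h s = G.rs le_top (φ m)
  right : ∀ (U : Opens X) (s : H.presheaf.obj (op U)), ∀ x ∈ U, ∃ (V : Opens X) (h : V ≤ U),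
    x ∈ V ∧ ∃ m, H.rs h s = H.rs le_top (ψ m)
  ker : ∀ (V : Opens X) (m : M), G.rs (le_top : V ≤ ⊤) (φ m) = 0 ↔ H.rs (le_top : V ≤ ⊤) (ψ m) = 0

namespace LocalModel

variable {G H : VSheaf X} {M : Type} [AddCommGroup M] [Module ℝ M]
  {φ : M →ₗ[ℝ] G.presheaf.obj (op ⊤)} {ψ : M →ₗ[ℝ] H.presheaf.obj (op ⊤)}

/-- The sections `s` and `t` are locally given by the same element of `M`. -/
def Corr (φ : M →ₗ[ℝ] G.presheaf.obj (op ⊤)) (ψ : M →ₗ[ℝ] H.presheaf.obj (op ⊤))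
    {U : Opens X} (s : G.presheaf.obj (op U)) (t : H.presheaf.obj (op U)) : Prop :=
  ∀ x ∈ U, ∃ (V : Opens X) (h : V ≤ U), x ∈ V ∧
    ∃ m, G.rs h s = G.rs le_top (φ m) ∧ H.rs h t = H.rs le_top (ψ m)

theorem symm (L : LocalModel G H φ ψ) : LocalModel H G ψ φ :=
  ⟨L.right, L.left, fun V m => (L.ker V m).symm⟩

theorem Corr.symm {U : Opens X} {s : G.presheaf.obj (op U)} {t : H.presheaf.obj (op U)}
    (h : Corr φ ψ s t) : Corr ψ φ t s := fun x hx =>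
  let ⟨V, hV, hxV, m, h₁, h₂⟩ := h x hx
  ⟨V, hV, hxV, m, h₂, h₁⟩

theorem Corr.add {U : Opens X} {s s' : G.presheaf.obj (op U)} {t t' : H.presheaf.obj (op U)}
    (h : Corr φ ψ s t) (h' : Corr φ ψ s' t') : Corr φ ψ (s + s') (t + t') := by
  intro x hx
  obtain ⟨V, hV, hxV, m, h₁, h₂⟩ := h x hx
  obtain ⟨V', hV', hxV', m', h₁', h₂'⟩ := h' x hx
  refine ⟨V ⊓ V', inf_le_left.trans hV, ⟨hxV, hxV'⟩, m + m', ?_, ?_⟩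
  · have e := congrArg (G.rs (inf_le_left : V ⊓ V' ≤ V)) h₁
    have e' := congrArg (G.rs (inf_le_right : V ⊓ V' ≤ V')) h₁'
    simp only [rs_rs] at e e'
    rw [map_add, e, e', map_add, map_add]
  · have e := congrArg (H.rs (inf_le_left : V ⊓ V' ≤ V)) h₂
    have e' := congrArg (H.rs (inf_le_right : V ⊓ V' ≤ V')) h₂'
    simp only [rs_rs] at e e'
    rw [map_add, e, e', map_add, map_add]

theorem Corr.smul {U : Opens X} {s : G.presheaf.obj (op U)} {t : H.presheaf.obj (op U)}
    (c : ℝ) (h : Corr φ ψ s t) : Corr φ ψ (c • s) (c • t) := by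
  intro x hx
  obtain ⟨V, hV, hxV, m, h₁, h₂⟩ := h x hx
  exact ⟨V, hV, hxV, c • m, by simp only [map_smul, h₁], by simp only [map_smul, h₂]⟩

theorem Corr.rs {U V : Opens X} {s : G.presheaf.obj (op U)} {t : H.presheaf.obj (op U)}
    (hVU : V ≤ U) (h : Corr φ ψ s t) : Corr φ ψ (G.rs hVU s) (H.rs hVU t) := by
  intro x hx
  obtain ⟨W, hW, hxW, m, h₁, h₂⟩ := h x (hVU hx)
  refine ⟨W ⊓ V, inf_le_right, ⟨hxW, hx⟩, m, ?_, ?_⟩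
  · have e := congrArg (G.rs (inf_le_left : W ⊓ V ≤ W)) h₁
    simpa only [rs_rs] using e
  · have e := congrArg (H.rs (inf_le_left : W ⊓ V ≤ W)) h₂
    simpa only [rs_rs] using e

theorem rs_eq (L : LocalModel G H φ ψ) {V : Opens X} {m m' : M}
    (h : G.rs (le_top : V ≤ ⊤) (φ m) = G.rs le_top (φ m')) :
    H.rs (le_top : V ≤ ⊤) (ψ m) = H.rs le_top (ψ m') := by
  have := L.ker V (m - m')
  simp only [map_sub, sub_eq_zero] at this
  exact this.1 h

/-- Two parameters giving the same section of `G` on an open set differ by an element of the kernel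
there. The kernels for `φ` and `ψ` agree, so the sections of `H` agree locally. -/
theorem Corr.unique (L : LocalModel G H φ ψ) {U : Opens X} {s : G.presheaf.obj (op U)}
    {t t' : H.presheaf.obj (op U)} (h : Corr φ ψ s t) (h' : Corr φ ψ s t') : t = t' := by
  apply H.ext_of_locally
  intro x hx
  obtain ⟨V, hV, hxV, m, h₁, h₂⟩ := h x hx
  obtain ⟨V', hV', hxV', m', h₁', h₂'⟩ := h' x hx
  refine ⟨V ⊓ V', inf_le_left.trans hV, ⟨hxV, hxV'⟩, ?_⟩
  have e₁ := congrArg (G.rs (inf_le_left : V ⊓ V' ≤ V)) h₁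
  have e₁' := congrArg (G.rs (inf_le_right : V ⊓ V' ≤ V')) h₁'
  have e₂ := congrArg (H.rs (inf_le_left : V ⊓ V' ≤ V)) h₂
  have e₂' := congrArg (H.rs (inf_le_right : V ⊓ V' ≤ V')) h₂'
  simp only [rs_rs] at e₁ e₁' e₂ e₂'
  rw [e₂, e₂']
  exact L.rs_eq (e₁.symm.trans e₁')

/-- Choose local parameters for `s` and transport them by `ψ`. On overlaps two parameters both
represent `s`, so their images in `H` agree and glue. -/
theorem exists_corr (L : LocalModel G H φ ψ) {U : Opens X} (s : G.presheaf.obj (op U)) :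
    ∃ t : H.presheaf.obj (op U), Corr φ ψ s t := by
  choose V hV hxV m hm using L.left U s
  obtain ⟨t, ht⟩ := H.exists_glue (fun x : U => V x.1 x.2) U (fun x => hV x.1 x.2)
    (fun x hx => ⟨⟨x, hx⟩, hxV x hx⟩) (fun x => H.rs le_top (ψ (m x.1 x.2))) (by
      intro x y
      simp only [rs_rs]
      apply L.rs_eq
      have e := congrArg (G.rs (inf_le_left : V x.1 x.2 ⊓ V y.1 y.2 ≤ _)) (hm x.1 x.2)
      have e' := congrArg (G.rs (inf_le_right : V x.1 x.2 ⊓ V y.1 y.2 ≤ _)) (hm y.1 y.2)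
      simp only [rs_rs] at e e'
      exact e.symm.trans e')
  exact ⟨t, fun x hx => ⟨V x hx, hV x hx, hxV x hx, m x hx, hm x hx, ht ⟨x, hx⟩⟩⟩

/-- The section of `H` corresponding to a section of `G`. -/
def transfer (L : LocalModel G H φ ψ) {U : Opens X} (s : G.presheaf.obj (op U)) :
    H.presheaf.obj (op U) :=
  (L.exists_corr s).choose

theorem corr_transfer (L : LocalModel G H φ ψ) {U : Opens X} (s : G.presheaf.obj (op U)) :
    Corr φ ψ s (L.transfer s) :=
  (L.exists_corr s).choose_spec

theorem transfer_eq (L : LocalModel G H φ ψ) {U : Opens X} {s : G.presheaf.obj (op U)}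
    {t : H.presheaf.obj (op U)} (h : Corr φ ψ s t) : L.transfer s = t :=
  Corr.unique L (L.corr_transfer s) h

/-- The morphism `G ⟶ H` sending a section to the corresponding one. -/
def hom (L : LocalModel G H φ ψ) : G ⟶ H := ⟨{
  app U := ModuleCat.ofHom {
    toFun s := L.transfer (U := U.unop) s
    map_add' s t := L.transfer_eq ((L.corr_transfer s).add (L.corr_transfer t))
    map_smul' c s := L.transfer_eq ((L.corr_transfer s).smul c) }
  naturality U V i := by
    ext s
    exact L.transfer_eq ((L.corr_transfer (U := U.unop) s).rs i.unop.le) }⟩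

/-- The isomorphism `G ≅ H` sending a section to the corresponding one. -/
def iso (L : LocalModel G H φ ψ) : G ≅ H where
  hom := L.hom
  inv := L.symm.hom
  hom_inv_id := by
    apply CategoryTheory.Sheaf.hom_ext
    ext U s
    exact L.symm.transfer_eq (L.corr_transfer (U := U.unop) s).symm
  inv_hom_id := by
    apply CategoryTheory.Sheaf.hom_ext
    ext U s
    exact L.transfer_eq (L.symm.corr_transfer (U := U.unop) s).symm

/-- Corresponding sections are determined locally by their parameters, so it is enough that `u` and
`v` act on parameters by one and the same map `w`, which need not be assumed linear. -/
theorem iso_hom_naturality {G' H' : VSheaf X} {M' : Type} [AddCommGroup M'] [Module ℝ M']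
    {φ' : M' →ₗ[ℝ] G'.presheaf.obj (op ⊤)} {ψ' : M' →ₗ[ℝ] H'.presheaf.obj (op ⊤)}
    (L : LocalModel G H φ ψ) (L' : LocalModel G' H' φ' ψ') (u : G ⟶ G') (v : H ⟶ H')
    (w : M → M') (hu : ∀ m, u.1.app (op ⊤) (φ m) = φ' (w m))
    (hv : ∀ m, v.1.app (op ⊤) (ψ m) = ψ' (w m)) :
    u ≫ L'.iso.hom = L.iso.hom ≫ v := by
  apply CategoryTheory.Sheaf.hom_ext
  ext U s
  refine L'.transfer_eq (U := U.unop) fun x hx => ?_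
  obtain ⟨V, hV, hxV, m, h₁, h₂⟩ := L.corr_transfer (U := U.unop) s x hx
  refine ⟨V, hV, hxV, w m, ?_, ?_⟩
  · have e := congrArg (u.1.app (op V)) h₁
    rw [app_rs, app_rs, hu] at e
    exact e
  · have e := congrArg (v.1.app (op V)) h₂
    rw [app_rs, app_rs, hv] at e
    exact e

end LocalModel

end VSheaf

/-! ### Constant sheaves and trivializing spaces of sections. -/

namespace VSheaf

variable {X : TopCat.{0}}

/-- The space `N` of sections over `W` trivializes `G` over `W`: it maps isomorphically onto
the stalks of `G` at the points of `W`. -/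
structure Trivializes (G : VSheaf X) (W : Opens X)
    (N : Submodule ℝ (G.presheaf.obj (op W))) : Prop where
  inj : ∀ (V : Opens X) (h : V ≤ W), ∀ x ∈ V, ∀ m ∈ N, G.rs h m = 0 → m = 0
  surj : ∀ (V : Opens X) (h : V ≤ W) (s : G.presheaf.obj (op V)), ∀ x ∈ V,
    ∃ (V' : Opens X) (h' : V' ≤ V), x ∈ V' ∧ ∃ m ∈ N, G.rs h' s = G.rs (h'.trans h) m

/-- The unit of sheafification is locally injective and locally surjective; `N` is the image of `M`
in the global sections. -/
theorem exists_trivializes_constantSheaf (M : ModuleCat.{0} ℝ) :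
    ∃ N, Trivializes ((constantSheaf (Opens.grothendieckTopology X) (ModuleCat.{0} ℝ)).obj M)
      ⊤ N := by
  let K : VSheaf X := (constantSheaf (Opens.grothendieckTopology X) (ModuleCat.{0} ℝ)).obj M
  let P : (Opens X)ᵒᵖ ⥤ ModuleCat.{0} ℝ := (Functor.const _).obj M
  let η : P ⟶ K.presheaf := toSheafify (Opens.grothendieckTopology X) P
  have : Presheaf.IsLocallyInjective (Opens.grothendieckTopology X) η :=
    inferInstanceAs (Presheaf.IsLocallyInjective _ (toSheafify _ P))
  have : Presheaf.IsLocallySurjective (Opens.grothendieckTopology X) η :=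
    inferInstanceAs (Presheaf.IsLocallySurjective _ (toSheafify _ P))
  have hnat : ∀ {V U : Opens X} (h : V ≤ U) (m : M),
      η.app (op V) m = K.rs h (η.app (op U) m) := fun h m =>
    NatTrans.naturality_apply η (homOfLE h).op m
  refine ⟨LinearMap.range (η.app (op ⊤)).hom, ?_, ?_⟩
  · rintro V h x hx _ ⟨m, rfl⟩ he
    have e : η.app (op V) m = η.app (op V) 0 := by
      rw [hnat h m, map_zero]
      exact he
    obtain ⟨V', i, hi, hxV'⟩ :=
      Presheaf.equalizerSieve_mem (Opens.grothendieckTopology X) η _ _ e x hx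
    -- Restriction maps of the constant presheaf are identities, so equality after restriction is
    -- equality in `M`.
    have : m = 0 := hi
    rw [this, map_zero]
  · intro V h s x hx
    obtain ⟨V', i, ⟨m, hm⟩, hxV'⟩ :=
      Presheaf.imageSieve_mem (Opens.grothendieckTopology X) η s x hx
    refine ⟨V', i.le, hxV', _, ⟨m, rfl⟩, ?_⟩
    exact hm.symm.trans (hnat _ m)

theorem Trivializes.of_iso {G H : VSheaf X} (e : G ≅ H) {W : Opens X}
    {N : Submodule ℝ (G.presheaf.obj (op W))} (hN : Trivializes G W N) :
    Trivializes H W (N.map (e.hom.1.app (op W)).hom) := by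
  have hi : ∀ {U : Opens X} (s : H.presheaf.obj (op U)),
      e.hom.1.app (op U) (e.inv.1.app (op U) s) = s := fun {U} s =>
    ConcreteCategory.congr_hom (congrArg (fun u => u.1.app (op U)) e.inv_hom_id) s
  have hi' : ∀ {U : Opens X} (s : G.presheaf.obj (op U)),
      e.inv.1.app (op U) (e.hom.1.app (op U) s) = s := fun {U} s =>
    ConcreteCategory.congr_hom (congrArg (fun u => u.1.app (op U)) e.hom_inv_id) s
  refine ⟨?_, ?_⟩
  · rintro V h x hx _ ⟨m, hm, rfl⟩ h0
    have : H.rs h (e.hom.1.app (op W) m) = 0 := h0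
    rw [← app_rs] at this
    have e0 := congrArg (e.inv.1.app (op V)) this
    rw [hi', map_zero] at e0
    rw [hN.inj V h x hx m hm e0, map_zero]
  · intro V h s x hx
    obtain ⟨V', h', hx', m, hm, hs⟩ := hN.surj V h (e.inv.1.app (op V) s) x hx
    refine ⟨V', h', hx', _, ⟨m, hm, rfl⟩, ?_⟩
    have := congrArg (e.hom.1.app (op V')) hs
    rw [app_rs, app_rs, hi] at this
    exact this

/-- For an open embedding, the sections of `hh.sheafPullback` over `V` are by definition those of
`G` over the image of `V`, so the same `N` serves on both sides. -/
theorem Trivializes.of_isOpenEmbedding {Y : TopCat.{0}} {h : Y ⟶ X}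
    (hh : Topology.IsOpenEmbedding h) (G : VSheaf X)
    {N : Submodule ℝ (((hh.sheafPullback (ModuleCat.{0} ℝ)).obj G).presheaf.obj (op ⊤))}
    (hN : Trivializes ((hh.sheafPullback (ModuleCat.{0} ℝ)).obj G) ⊤ N) :
    Trivializes G (hh.functor.obj ⊤) N := by
  have key : ∀ V : Opens X, V ≤ hh.functor.obj ⊤ → ∃ V', hh.functor.obj V' = V := by
    intro V hV
    refine ⟨(Opens.map h).obj V, Opens.ext (Set.image_preimage_eq_of_subset ?_)⟩
    exact fun x hx => let ⟨y, _, hy⟩ := hV hx; ⟨y, hy⟩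
  refine ⟨?_, ?_⟩
  · intro V hV x hx m hm h0
    obtain ⟨V, rfl⟩ := key V hV
    obtain ⟨y, hy, rfl⟩ := hx
    exact hN.inj V le_top y hy m hm h0
  · intro V hV s x hx
    obtain ⟨V, rfl⟩ := key V hV
    obtain ⟨y, hy, rfl⟩ := hx
    obtain ⟨V', hV', hy', m, hm, hs⟩ := hN.surj V le_top s y hy
    exact ⟨hh.functor.obj V', (hh.functor.map (homOfLE hV')).le, ⟨y, hy', rfl⟩, m, hm, hs⟩

/-- Inverse images compose. -/
def inverseImageComp {Y Z : TopCat.{0}} (g : X ⟶ Y) (h : Y ⟶ Z) :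
    inverseImage h ⋙ inverseImage g ≅ inverseImage (g ≫ h) :=
  Adjunction.leftAdjointUniq
    ((TopCat.Sheaf.pullbackPushforwardAdjunction (ModuleCat.{0} ℝ) h).comp
      (TopCat.Sheaf.pullbackPushforwardAdjunction (ModuleCat.{0} ℝ) g))
    (TopCat.Sheaf.pullbackPushforwardAdjunction (ModuleCat.{0} ℝ) (g ≫ h))

/-- The inclusion of `W` in `X` need not be open, but that of `W` in `A` is. Factoring the
restriction through `A` turns constancy on `W` into a statement about sections of `F|_A` over an
open set. -/
theorem IsConstantOn.exists_trivializes {F : VSheaf X} {A W : Set X} (hF : F.IsConstantOn W)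
    (hWA : W ⊆ A) (hW : IsOpen (Subtype.val ⁻¹' W : Set A)) :
    ∃ N, Trivializes ((restrict A).obj F) ⟨Subtype.val ⁻¹' W, hW⟩ N := by
  let h : TopCat.of W ⟶ TopCat.of A := TopCat.ofHom ⟨Set.inclusion hWA, continuous_inclusion hWA⟩
  have hr : Set.range h = Subtype.val ⁻¹' W := Set.range_inclusion hWA
  have hh : Topology.IsOpenEmbedding h :=
    ⟨Topology.IsEmbedding.inclusion hWA, by rw [hr]; exact hW⟩
  obtain ⟨M, ⟨e⟩⟩ := hF.mem_essImage
  obtain ⟨N, hN⟩ := exists_trivializes_constantSheaf (X := TopCat.of W) M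
  have hN' := (hN.of_iso (e ≪≫ (inverseImageComp h (subspaceIncl A)).symm.app F ≪≫
    (hh.sheafPullbackIso (ModuleCat.{0} ℝ)).app _)).of_isOpenEmbedding hh
  have hU : hh.functor.obj ⊤ = (⟨Subtype.val ⁻¹' W, hW⟩ : Opens (TopCat.of A)) :=
    Opens.ext (Set.image_univ.trans hr)
  rw [← hU]
  exact ⟨_, hN'⟩

end VSheaf

/-! ### Direct images under homeomorphisms preserving an open partition. -/

namespace VSheaf

variable {X : TopCat.{0}}

/-- The pushforward along a self-homeomorphism. -/
abbrev push (g : X ≃ₜ X) : VSheaf X ⥤ VSheaf X :=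
  TopCat.Sheaf.pushforward (ModuleCat.{0} ℝ) (TopCat.ofHom (g : C(X, X)))

/-- Every section of `G` is locally the restriction of a global section in the image of `φ`. -/
def LocallyGenerates (G : VSheaf X) {M : Type} [AddCommGroup M] [Module ℝ M]
    (φ : M →ₗ[ℝ] G.presheaf.obj (op ⊤)) : Prop :=
  ∀ (U : Opens X) (s : G.presheaf.obj (op U)), ∀ x ∈ U, ∃ (V : Opens X) (h : V ≤ U),
    x ∈ V ∧ ∃ m, G.rs h s = G.rs le_top (φ m)

/-- The global section `s` vanishes near `x`. -/
def VanishesAt (G : VSheaf X) (s : G.presheaf.obj (op ⊤)) (x : X) : Prop :=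
  ∃ V : Opens X, x ∈ V ∧ G.rs (le_top : V ≤ ⊤) s = 0

theorem rs_eq_zero_iff (G : VSheaf X) (V : Opens X) (s : G.presheaf.obj (op ⊤)) :
    G.rs (le_top : V ≤ ⊤) s = 0 ↔ ∀ x ∈ V, G.VanishesAt s x := by
  constructor
  · exact fun h x hx => ⟨V, hx, h⟩
  · intro h
    apply G.ext_of_locally
    intro x hx
    obtain ⟨V', hx', h'⟩ := h x hx
    refine ⟨V' ⊓ V, inf_le_right, ⟨hx', hx⟩, ?_⟩
    have e := congrArg (G.rs (inf_le_left : V' ⊓ V ≤ V')) h'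
    simpa only [rs_rs, map_zero] using e

theorem LocallyGenerates.localModel {G : VSheaf X} {M : Type} [AddCommGroup M] [Module ℝ M]
    {φ : M →ₗ[ℝ] G.presheaf.obj (op ⊤)} (hφ : G.LocallyGenerates φ) (g : X ≃ₜ X)
    (hg : ∀ m x, G.VanishesAt (φ m) (g x) ↔ G.VanishesAt (φ m) x) :
    LocalModel G ((push g).obj G) φ φ where
  left := hφ
  right := by
    intro U s x hx
    -- A section of the direct image over `U` is a section of `G` over `g⁻¹(U)`, so the point to use
    -- is `g⁻¹(x)`; the neighbourhood `V` found there is carried back to `g(V)`.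
    obtain ⟨V, hV, hxV, m, hm⟩ := hφ _ s (g.symm x)
      (show g (g.symm x) ∈ U by rwa [g.apply_symm_apply])
    let V' : Opens X := ⟨g.symm ⁻¹' V, V.isOpen.preimage g.symm.continuous⟩
    have hle : (Opens.map (TopCat.ofHom (g : C(X, X)))).obj V' ≤ V := by
      intro y hy
      have : g.symm (g y) ∈ V := hy
      rwa [g.symm_apply_apply] at this
    refine ⟨V', ?_, hxV, m, ?_⟩
    · intro y hy
      have : g (g.symm y) ∈ U := hV hy
      rwa [g.apply_symm_apply] at this
    · have e := congrArg (G.rs hle) hm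
      rw [rs_rs] at e
      exact (G.rs_rs hle hV s).symm.trans e
  ker := by
    intro V m
    change _ ↔ G.rs (le_top : (Opens.map (TopCat.ofHom (g : C(X, X)))).obj V ≤ ⊤) (φ m) = 0
    rw [rs_eq_zero_iff, rs_eq_zero_iff]
    constructor
    · exact fun h x hx => (hg m x).1 (h (g x) hx)
    · intro h x hx
      have := (hg m (g.symm x)).2
        (h (g.symm x) (show g (g.symm x) ∈ V by rwa [g.apply_symm_apply]))
      rwa [g.apply_symm_apply] at this

section Partition

variable {G : VSheaf X} {ι : Type} {W : ι → Opens X}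
  (hdis : Pairwise fun a b => Disjoint (W a) (W b)) (hcov : ∀ x, ∃ a, x ∈ W a)
  {N : ∀ a, Submodule ℝ (G.presheaf.obj (op (W a)))} (hN : ∀ a, Trivializes G (W a) (N a))

include hdis hcov

/-- Distinct pieces have empty intersection, so the gluing condition is vacuous. -/
theorem exists_extension (G : VSheaf X) (s : ∀ a, G.presheaf.obj (op (W a))) :
    ∃ t : G.presheaf.obj (op ⊤), ∀ a, G.rs le_top t = s a := by
  refine G.exists_glue W ⊤ (fun _ => le_top) (fun x _ => hcov x) s fun a b => ?_
  by_cases hab : a = b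
  · subst hab
    rfl
  · apply G.ext_of_locally
    intro x hx
    exact ((hdis hab).le_bot hx).elim

include hN

theorem exists_global_of_trivializes (U : Opens X) (s : G.presheaf.obj (op U)) (x : X)
    (hx : x ∈ U) : ∃ (V : Opens X) (h : V ≤ U), x ∈ V ∧ ∃ t : G.presheaf.obj (op ⊤),
      (∀ a, G.rs le_top t ∈ N a) ∧ G.rs h s = G.rs le_top t := by
  classical
  obtain ⟨a, ha⟩ := hcov x
  obtain ⟨V, hV, hxV, m, hm, hs⟩ := (hN a).surj (U ⊓ W a) inf_le_right
    (G.rs inf_le_left s) x ⟨hx, ha⟩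
  -- The local generator is extended by zero to the other pieces.
  obtain ⟨t, ht⟩ := exists_extension hdis hcov G (Pi.single a m)
  refine ⟨V, hV.trans inf_le_left, hxV, t, ?_, ?_⟩
  · intro b
    rw [ht b]
    by_cases hab : b = a
    · subst hab
      rwa [Pi.single_eq_same]
    · rw [Pi.single_eq_of_ne hab]
      exact zero_mem _
  · rw [rs_rs] at hs
    have e := congrArg (G.rs (hV.trans inf_le_right)) (ht a)
    rw [rs_rs, Pi.single_eq_same] at e
    exact hs.trans e.symm

omit hdis hcov in
theorem Trivializes.eq_zero_of_vanishesAt {a : ι} {s : G.presheaf.obj (op ⊤)}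
    (hs : G.rs le_top s ∈ N a) {x : X} (hx : x ∈ W a) (h : G.VanishesAt s x) :
    G.rs (le_top : W a ≤ ⊤) s = 0 := by
  obtain ⟨V, hxV, hV⟩ := h
  refine (hN a).inj (V ⊓ W a) inf_le_right x ⟨hxV, hx⟩ _ hs ?_
  have e := congrArg (G.rs (inf_le_left : V ⊓ W a ≤ V)) hV
  simpa only [rs_rs, map_zero] using e

/-- A sheaf which is trivial on the members of an open partition is isomorphic to its direct image
under a homeomorphism preserving these members. -/
theorem nonempty_iso_push_of_trivializes (g : X ≃ₜ X) (hg : ∀ a x, g x ∈ W a ↔ x ∈ W a) :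
    Nonempty (G ≅ (push g).obj G) := by
  -- Not all global sections can be used: `g` may permute the components of a disconnected `W a`,
  -- and a section may vanish on only some of them. Those lying in `N a` on each piece vanish on all
  -- of it or at none of its points.
  let Q : Submodule ℝ (G.presheaf.obj (op ⊤)) := ⨅ a, (N a).comap (G.rs le_top)
  have hQ : ∀ s, s ∈ Q ↔ ∀ a, G.rs le_top s ∈ N a := fun s => by
    simp only [Q, Submodule.mem_iInf, Submodule.mem_comap]
  have hgen : G.LocallyGenerates Q.subtype := by
    intro U s x hx
    obtain ⟨V, hV, hxV, t, ht, hs⟩ := exists_global_of_trivializes hdis hcov hN U s x hx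
    exact ⟨V, hV, hxV, ⟨t, (hQ t).2 ht⟩, hs⟩
  refine ⟨(hgen.localModel g fun m x => ?_).iso⟩
  obtain ⟨a, ha⟩ := hcov x
  have ha' := (hg a x).2 ha
  have hm := (hQ m.1).1 m.2 a
  exact ⟨fun h => ⟨W a, ha, Trivializes.eq_zero_of_vanishesAt hN hm ha' h⟩,
    fun h => ⟨W a, ha', Trivializes.eq_zero_of_vanishesAt hN hm ha h⟩⟩

omit hdis hcov in
-- The vanishing locus is open. It is also closed in `W a`: near any point the section agrees with
-- some `m ∈ N a`, and if `m` vanishes at a single nearby point then `m = 0`.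
theorem Trivializes.vanishesAt_of_isPreconnected {a : ι} (hc : IsPreconnected (W a : Set X))
    (s : G.presheaf.obj (op ⊤)) {x y : X} (hx : x ∈ W a) (hy : y ∈ W a)
    (h : G.VanishesAt s x) : G.VanishesAt s y := by
  by_contra hy0
  have hopen : IsOpen {z | G.VanishesAt s z} := by
    rw [isOpen_iff_mem_nhds]
    rintro z ⟨V, hz, hV⟩
    exact Filter.mem_of_superset (V.isOpen.mem_nhds hz) fun z' hz' => ⟨V, hz', hV⟩
  -- The interior of the nonvanishing locus; on `W a` it turns out to be the whole nonvanishing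
  -- locus.
  let T : Set X := {z | ∃ V : Opens X, z ∈ V ∧ ∀ z' ∈ V, ¬ G.VanishesAt s z'}
  have hT : IsOpen T := by
    rw [isOpen_iff_mem_nhds]
    rintro z ⟨V, hz, hV⟩
    exact Filter.mem_of_superset (V.isOpen.mem_nhds hz) fun z' hz' => ⟨V, hz', hV⟩
  have hdich : ∀ z ∈ W a, ¬ G.VanishesAt s z → z ∈ T := by
    intro z hz hz0
    obtain ⟨V, hV, hzV, m, hm, hs⟩ := (hN a).surj (W a) le_rfl (G.rs le_top s) z hz
    rw [rs_rs] at hs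
    refine ⟨V, hzV, ?_⟩
    rintro z' hz' ⟨V', hzV', hV'⟩
    refine hz0 ⟨V, hzV, ?_⟩
    have e := congrArg (G.rs (inf_le_left : V' ⊓ V ≤ V')) hV'
    have e' := congrArg (G.rs (inf_le_right : V' ⊓ V ≤ V)) hs
    simp only [rs_rs, map_zero] at e e'
    rw [hs, (hN a).inj (V' ⊓ V) (inf_le_right.trans hV) z' ⟨hzV', hz'⟩ m hm (e'.symm.trans e), map_zero]
  obtain ⟨z, -, hz, V, hzV, hV⟩ := hc _ T hopen hT
    (fun z hz => or_iff_not_imp_left.2 (hdich z hz)) ⟨x, hx, h⟩ ⟨y, hy, hdich y hy hy0⟩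
  exact hV z hzV hz

/-- A sheaf which is trivial on the members of a partition into connected open sets is canonically
isomorphic to its direct image under a homeomorphism preserving these members. -/
theorem localModel_push_of_isPreconnected (hc : ∀ a, IsPreconnected (W a : Set X)) (g : X ≃ₜ X)
    (hg : ∀ a x, g x ∈ W a ↔ x ∈ W a) :
    LocalModel G ((push g).obj G) LinearMap.id LinearMap.id := by
  -- All global sections are kept, so the trivializations `N` do not enter the resulting
  -- isomorphism.
  have hgen : G.LocallyGenerates LinearMap.id := by
    intro U s x hx
    obtain ⟨V, hV, hxV, t, -, hs⟩ := exists_global_of_trivializes hdis hcov hN U s x hx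
    exact ⟨V, hV, hxV, t, hs⟩
  refine hgen.localModel g fun m x => ?_
  obtain ⟨a, ha⟩ := hcov x
  have ha' := (hg a x).2 ha
  exact ⟨Trivializes.vanishesAt_of_isPreconnected hN (hc a) m ha' ha,
    Trivializes.vanishesAt_of_isPreconnected hN (hc a) m ha ha'⟩

end Partition

end VSheaf

/-! ### Inverse images, extension by zero and the associated sheaf. -/

namespace VSheaf

variable {X : TopCat.{0}}

/-- The inverse image along a homeomorphism is the direct image along its inverse. -/
def inverseImageHomeoIso (f : X ≃ₜ X) :
    inverseImage (TopCat.ofHom (f : C(X, X))) ≅ push f.symm :=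
  have hf : Topology.IsOpenEmbedding (TopCat.ofHom (f : C(X, X))) := f.isOpenEmbedding
  haveI := Topology.IsOpenEmbedding.functor_isContinuous hf
  -- The inverse image along an open embedding takes sections over `f(U)`, and `f(U)` is the
  -- preimage of `U` under `f⁻¹`.
  let e : Opens.map (TopCat.ofHom (f.symm : C(X, X))) ≅ hf.functor :=
    NatIso.ofComponents (fun U =>
      eqToIso (Opens.ext (f.toEquiv.image_eq_preimage_symm (U : Set X)).symm))
      (fun _ => Subsingleton.elim _ _)
  hf.sheafPullbackIso (ModuleCat.{0} ℝ) ≪≫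
    (Functor.sheafPushforwardContinuousIso e (ModuleCat.{0} ℝ)
      (Opens.grothendieckTopology X) (Opens.grothendieckTopology X)).symm

/-- The restriction of the inverse of a homeomorphism to an invariant subspace. -/
def symmRestrict (f : X ≃ₜ X) {A : Set X} (hA : f '' A = A) : A ≃ₜ A where
  toFun x := ⟨f.symm x, by
    obtain ⟨y, hy, hx⟩ := hA.symm.subset x.2
    rwa [← hx, f.symm_apply_apply]⟩
  invFun x := ⟨f x, hA.subset ⟨x, x.2, rfl⟩⟩
  left_inv x := Subtype.ext (f.apply_symm_apply x)
  right_inv x := Subtype.ext (f.symm_apply_apply x)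
  continuous_toFun := by fun_prop
  continuous_invFun := by fun_prop

/-- Both conditions ask for vanishing near the points outside `A`; `f` preserves the complement of
`A` and carries the neighbourhoods for one condition to those for the other. -/
theorem mem_sections_push_iff (f : X ≃ₜ X) {A : Set X} (hA : f '' A = A)
    (G : VSheaf (TopCat.of A)) (U : Opens X)
    (s : G.presheaf.obj (op (ExtensionByZero.trace A
      ((Opens.map (TopCat.ofHom (f.symm : C(X, X)))).obj U)))) :
    s ∈ ExtensionByZero.sections ((push (X := TopCat.of A) (symmRestrict f hA)).obj G) U ↔
      s ∈ ExtensionByZero.sections G ((Opens.map (TopCat.ofHom (f.symm : C(X, X)))).obj U) := by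
  have hfA : ∀ x, f x ∈ A ↔ x ∈ A := fun x => by
    conv_lhs => rw [← hA]
    exact f.injective.mem_set_image
  refine (ExtensionByZero.mem_sections_iff
    ((push (X := TopCat.of A) (symmRestrict f hA)).obj G) U s).trans
    (Iff.trans ?_ (ExtensionByZero.mem_sections_iff G _ s).symm)
  constructor
  · intro H x hx hxA
    obtain ⟨V, hV, hxV, h0⟩ := H (f.symm x) hx
      (fun h => hxA (by rw [← f.apply_symm_apply x]; exact (hfA _).2 h))
    exact ⟨(Opens.map (TopCat.ofHom (f.symm : C(X, X)))).obj V, fun y hy => hV hy, hxV, h0⟩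
  · intro H x hx hxA
    obtain ⟨V, hV, hxV, h0⟩ := H (f x)
      (show f.symm (f x) ∈ U by rwa [f.symm_apply_apply]) (fun h => hxA ((hfA x).1 h))
    let V' : Opens X := (Opens.map (TopCat.ofHom (f : C(X, X)))).obj V
    have hV' : V' ≤ U := fun y hy => by
      have : f.symm (f y) ∈ U := hV hy
      rwa [f.symm_apply_apply] at this
    refine ⟨V', hV', hxV, ?_⟩
    have hle : ExtensionByZero.trace A
        ((Opens.map (TopCat.ofHom (f.symm : C(X, X)))).obj V') ≤ ExtensionByZero.trace A V := by
      intro y hy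
      have : f (f.symm y) ∈ V := hy
      rwa [f.apply_symm_apply] at this
    have e := congrArg (G.rs hle) h0
    rw [map_zero] at e
    exact (G.rs_rs hle _ s).symm.trans e

/-- Extension by zero commutes with direct images under homeomorphisms. -/
def extensionByZeroPushIso (f : X ≃ₜ X) {A : Set X} (hA : f '' A = A) :
    push (X := TopCat.of A) (symmRestrict f hA) ⋙ extensionByZero A ≅
      extensionByZero A ⋙ push f.symm where
  hom := {
    app G := ⟨{
      app U := ModuleCat.ofHom {
        toFun s := ⟨s.1, (mem_sections_push_iff f hA G U.unop s.1).1 s.2⟩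
        map_add' _ _ := rfl
        map_smul' _ _ := rfl }
      naturality _ _ _ := rfl }⟩
    naturality _ _ _ := rfl }
  inv := {
    app G := ⟨{
      app U := ModuleCat.ofHom {
        toFun s := ⟨s.1, (mem_sections_push_iff f hA G U.unop s.1).2 s.2⟩
        map_add' _ _ := rfl
        map_smul' _ _ := rfl }
      naturality _ _ _ := rfl }⟩
    naturality _ _ _ := rfl }
  hom_inv_id := rfl
  inv_hom_id := rfl

instance (g : X ≃ₜ X) : (push g).Additive where
  map_add := rfl

/-- Reduces naturality for the associated sheaf to its summands: compare after each projection,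
using that `T` sends projections to projections. -/
theorem mapBiproduct_comp_map_naturality {C : Type*} [Category* C] [Preadditive C] {J : Type}
    [Finite J] [HasFiniteBiproducts C] (T : C ⥤ C) [T.Additive] {B B' : J → C}
    (φ : ∀ j, B j ⟶ B' j) (ψ : ∀ j, T.obj (B j) ⟶ B j) (ψ' : ∀ j, T.obj (B' j) ⟶ B' j)
    (h : ∀ j, T.map (φ j) ≫ ψ' j = ψ j ≫ φ j) :
    T.map (biproduct.map φ) ≫ ((T.mapBiproduct B').hom ≫
      (biproduct.map ψ' : ⨁ (T.obj ∘ B') ⟶ ⨁ B')) =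
      ((T.mapBiproduct B).hom ≫ (biproduct.map ψ : ⨁ (T.obj ∘ B) ⟶ ⨁ B)) ≫
        biproduct.map φ := by
  apply biproduct.hom_ext
  intro j
  have hπ : ∀ B : J → C, (T.mapBiproduct B).hom ≫ biproduct.π (T.obj ∘ B) j =
      T.map (biproduct.π B j) := fun B => by
    rw [Functor.mapBiproduct_hom]
    exact biproduct.lift_π _ _
  have e' : (biproduct.map ψ' : ⨁ (T.obj ∘ B') ⟶ ⨁ B') ≫ biproduct.π B' j =
    biproduct.π (T.obj ∘ B') j ≫ ψ' j := biproduct.map_π _ _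
  have e : (biproduct.map ψ : ⨁ (T.obj ∘ B) ⟶ ⨁ B) ≫ biproduct.π B j =
    biproduct.π (T.obj ∘ B) j ≫ ψ j := biproduct.map_π _ _
  rw [Category.assoc, Category.assoc, Category.assoc, e', biproduct.map_π, Category.assoc,
    reassoc_of% e, reassoc_of% (hπ B'), reassoc_of% (hπ B), ← h j, ← T.map_comp_assoc,
    ← T.map_comp_assoc, biproduct.map_π]

/-- The isomorphism `(f⁻¹)_* i_! G ≅ i_! G` induced by `G ≅ (f⁻¹)_* G`. -/
def extensionByZeroIso (f : X ≃ₜ X) {A : Set X} (hA : f '' A = A) {G : VSheaf (TopCat.of A)}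
    (e : G ≅ (push (X := TopCat.of A) (symmRestrict f hA)).obj G) :
    (push f.symm).obj ((extensionByZero A).obj G) ≅ (extensionByZero A).obj G :=
  (extensionByZeroPushIso f hA).symm.app G ≪≫ (extensionByZero A).mapIso e.symm

theorem extensionByZeroIso_hom_naturality (f : X ≃ₜ X) {A : Set X} (hA : f '' A = A)
    {G G' : VSheaf (TopCat.of A)}
    (e : G ≅ (push (X := TopCat.of A) (symmRestrict f hA)).obj G)
    (e' : G' ≅ (push (X := TopCat.of A) (symmRestrict f hA)).obj G') (u : G ⟶ G')
    (hu : u ≫ e'.hom = e.hom ≫ (push (X := TopCat.of A) (symmRestrict f hA)).map u) :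
    (push f.symm).map ((extensionByZero A).map u) ≫ (extensionByZeroIso f hA e').hom =
      (extensionByZeroIso f hA e).hom ≫ (extensionByZero A).map u := by
  have h₁ := (extensionByZeroPushIso f hA).inv.naturality u
  have h₂ : (push (X := TopCat.of A) (symmRestrict f hA)).map u ≫ e'.inv = e.inv ≫ u := by
    rw [Iso.comp_inv_eq, Category.assoc, hu, Iso.inv_hom_id_assoc]
  change _ ≫ (_ ≫ (extensionByZero A).map e'.inv) =
    (_ ≫ (extensionByZero A).map e.inv) ≫ (extensionByZero A).map u
  rw [Category.assoc, ← Functor.map_comp, ← h₂, Functor.map_comp, ← Category.assoc,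
    ← Category.assoc]
  exact congrArg (· ≫ (extensionByZero A).map e'.inv) h₁

/-- The direct image of the associated sheaf under `f⁻¹`, from isomorphisms on the members of the
family. -/
def pushAssociatedIso (f : X ≃ₜ X) {k : ℕ} (P : Fin k → Set X) (hP : ∀ j, f '' P j = P j)
    (F : VSheaf X) (e : ∀ j, (restrict (P j)).obj F ≅
      (push (X := TopCat.of (P j)) (symmRestrict f (hP j))).obj ((restrict (P j)).obj F)) :
    (push f.symm).obj ((associated P).obj F) ≅ (associated P).obj F :=
  (push f.symm).mapBiproduct (fun j => (extensionByZero (P j)).obj ((restrict (P j)).obj F)) ≪≫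
    biproduct.mapIso fun j => extensionByZeroIso f (hP j) (e j)

variable (f : X ≃ₜ X) {k : ℕ} (P : Fin k → Set X) (hP : ∀ j, f '' P j = P j) {F F' : VSheaf X}
    (e : ∀ j, (restrict (P j)).obj F ≅
      (push (X := TopCat.of (P j)) (symmRestrict f (hP j))).obj ((restrict (P j)).obj F))
    (e' : ∀ j, (restrict (P j)).obj F' ≅
      (push (X := TopCat.of (P j)) (symmRestrict f (hP j))).obj ((restrict (P j)).obj F'))
    (u : F ⟶ F') (hu : ∀ j, (restrict (P j)).map u ≫ (e' j).hom = (e j).hom ≫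
      (push (X := TopCat.of (P j)) (symmRestrict f (hP j))).map ((restrict (P j)).map u))

include hu

theorem pushAssociatedIso_hom_naturality :
    (push f.symm).map ((associated P).map u) ≫ (pushAssociatedIso f P hP F' e').hom =
      (pushAssociatedIso f P hP F e).hom ≫ (associated P).map u :=
  mapBiproduct_comp_map_naturality (push f.symm)
    (B := fun j => (extensionByZero (P j)).obj ((restrict (P j)).obj F))
    (B' := fun j => (extensionByZero (P j)).obj ((restrict (P j)).obj F'))
    (fun j => (extensionByZero (P j)).map ((restrict (P j)).map u))
    (fun j => (extensionByZeroIso f (hP j) (e j)).hom)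
    (fun j => (extensionByZeroIso f (hP j) (e' j)).hom)
    (fun j => extensionByZeroIso_hom_naturality f (hP j) (e j) (e' j) _ (hu j))

omit hu

/-- An isomorphism between the associated sheaf and its inverse image, from isomorphisms on the
members of the family. -/
def associatedIso :
    (inverseImage (TopCat.ofHom (f : C(X, X)))).obj ((associated P).obj F) ≅
      (associated P).obj F :=
  (inverseImageHomeoIso f).app ((associated P).obj F) ≪≫ pushAssociatedIso f P hP F e

include hu

theorem associatedIso_hom_naturality :
    (inverseImage (TopCat.ofHom (f : C(X, X)))).map ((associated P).map u) ≫
      (associatedIso f P hP e').hom = (associatedIso f P hP e).hom ≫ (associated P).map u := by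
  have hnat := (inverseImageHomeoIso f).hom.naturality ((associated P).map u)
  simp only [associatedIso, Iso.trans_hom, Iso.app_hom, Category.assoc]
  rw [← pushAssociatedIso_hom_naturality f P hP e e' u hu, ← Category.assoc, hnat, Category.assoc]

end VSheaf

/-! ### Cells and the finiteness of connected components. -/

theorem Topology.RelCWComplex.isPreconnected_openCell {E : Type*} [TopologicalSpace E]
    {C D : Set E} [Topology.RelCWComplex C D] (m : ℕ) (e : Topology.RelCWComplex.cell C m) :
    IsPreconnected (Topology.RelCWComplex.openCell (C := C) m e) :=
  (convex_ball _ _).isPreconnected.image _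
    ((Topology.RelCWComplex.continuousOn m e).mono Metric.ball_subset_closedBall)

/-- Choose for each component a cell of `U` meeting it. Cells are connected, so the choice is
injective, and there are finitely many cells. -/
theorem IsIncompleteSubcomplex.finite_connectedComponents {n : ℕ} {X : Set (Fin n → ℝ)}
    [Topology.CWComplex X] (hX : Topology.CWComplex.Finite X) {U : Set X}
    (hU : IsIncompleteSubcomplex X U) : Finite (_root_.ConnectedComponents U) := by
  obtain ⟨I, hI⟩ := hU
  have hfin : Finite (Σ m, Topology.CWComplex.cell X m) :=
    Topology.RelCWComplex.finite_cells_of_finite (finite := hX)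
  let ι : U → Fin n → ℝ := fun y => y.1.1
  have hι : Topology.IsInducing ι :=
    Topology.IsInducing.subtypeVal.comp Topology.IsInducing.subtypeVal
  have hcell : ∀ c : _root_.ConnectedComponents U, ∃ e : Σ m, Topology.CWComplex.cell X m,
      e.2 ∈ I e.1 ∧ ∃ y : U, _root_.ConnectedComponents.mk y = c ∧
        ι y ∈ Topology.RelCWComplex.openCell (C := X) e.1 e.2 := by
    intro c
    obtain ⟨y, rfl⟩ := _root_.ConnectedComponents.surjective_coe c
    have hy : ι y ∈ (Subtype.val '' U : Set (Fin n → ℝ)) := ⟨y.1, y.2, rfl⟩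
    rw [hI] at hy
    simp only [Set.mem_iUnion] at hy
    obtain ⟨m, e, he, hy⟩ := hy
    exact ⟨⟨m, e⟩, he, y, rfl, hy⟩
  choose e he y hy hye using hcell
  refine Finite.of_injective e fun c d hcd => ?_
  have hd := hye d
  rw [← hcd] at hd
  rw [← hy c, ← hy d, _root_.ConnectedComponents.coe_eq_coe']
  -- Connectedness passes from `ℝⁿ` to `U` because the topology is induced and the cell lies
  -- entirely in `U`.
  have hpre : _root_.IsPreconnected (ι ⁻¹' Topology.RelCWComplex.openCell (C := X) (e c).1 (e c).2) := by
    rw [← hι.isPreconnected_image, Set.image_preimage_eq_of_subset]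
    · exact Topology.RelCWComplex.isPreconnected_openCell _ _
    · intro z hz
      have hz' : z ∈ (Subtype.val '' U : Set (Fin n → ℝ)) := by
        rw [hI]
        simp only [Set.mem_iUnion]
        exact ⟨_, _, he c, hz⟩
      obtain ⟨w, hw, rfl⟩ := hz'
      exact ⟨⟨w, hw⟩, rfl⟩
  exact hpre.subset_connectedComponent hd (hye c)

/-! ### The comparison on each member of the partition. -/

namespace VSheaf

variable {X : TopCat.{0}}

theorem symmRestrict_coe_mem_iff (f : X ≃ₜ X) {A W : Set X} (hA : f '' A = A) (hW : f '' W = W)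
    (x : A) : (symmRestrict f hA x : X) ∈ W ↔ (x : X) ∈ W := by
  change f.symm (x : X) ∈ W ↔ _
  conv_rhs => rw [← hW, ← f.apply_symm_apply (x : X)]
  exact f.injective.mem_set_image.symm

theorem RespectsConstantComponents.nonempty_iso_push {f : X ≃ₜ X} {k : ℕ} {P : Fin k → Set X}
    {F : VSheaf X} (hF : RespectsConstantComponents f P F) (hP : ∀ j, f '' P j = P j) (j : Fin k) :
    Nonempty ((restrict (P j)).obj F ≅
      (push (X := TopCat.of (P j)) (symmRestrict f (hP j))).obj ((restrict (P j)).obj F)) := by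
  obtain ⟨m, W, hdis, hcov, hW⟩ := hF j
  choose N hN using fun a => (hW a).2.2.exists_trivializes
    (hcov ▸ Set.subset_iUnion W a) (hW a).1
  refine nonempty_iso_push_of_trivializes (fun a b hab => ?_) (fun x => ?_) hN
    (symmRestrict f (hP j)) (fun a x => symmRestrict_coe_mem_iff f (hP j) (hW a).2.1 x)
  · refine disjoint_iff_inf_le.2 ?_
    exact fun x hx => Set.disjoint_left.1 (hdis hab) hx.1 hx.2
  · have hx : (x : X) ∈ ⋃ a, W a := by
      rw [hcov]
      exact x.2
    obtain ⟨a, ha⟩ := Set.mem_iUnion.1 hx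
    exact ⟨a, ha⟩

theorem localModel_push_of_connectedComponentIn (f : X ≃ₜ X) {A : Set X} (hA : f '' A = A)
    [Finite (_root_.ConnectedComponents A)]
    (hf : ∀ x ∈ A, f '' connectedComponentIn A x = connectedComponentIn A x) (F : VSheaf X)
    (hF : ∀ x ∈ A, F.IsConstantOn (connectedComponentIn A x)) :
    LocalModel ((restrict A).obj F)
      ((push (X := TopCat.of A) (symmRestrict f hA)).obj ((restrict A).obj F))
      LinearMap.id LinearMap.id := by
  let r : _root_.ConnectedComponents A → A := Quotient.out
  have hr : ∀ c, _root_.ConnectedComponents.mk (r c) = c := Quotient.out_eq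
  have hpre : ∀ c, (Subtype.val ⁻¹' connectedComponentIn A (r c) : Set A) =
      _root_.ConnectedComponents.mk ⁻¹' {c} := fun c => by
    rw [connectedComponentIn_eq_image (r c).2, Set.preimage_image_eq _ Subtype.val_injective]
    conv_rhs => rw [← hr c]
    exact connectedComponents_preimage_singleton.symm
  have hopen : ∀ c, IsOpen (Subtype.val ⁻¹' connectedComponentIn A (r c) : Set A) := fun c => by
    rw [hpre c]
    -- The space of components is totally disconnected, hence T1, and finite, hence discrete.
    exact (isOpen_discrete _).preimage _root_.ConnectedComponents.continuous_coe
  choose N hN using fun c => (hF _ (r c).2).exists_trivializes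
    (connectedComponentIn_subset A (r c)) (hopen c)
  refine localModel_push_of_isPreconnected (fun a b hab => ?_) (fun x => ?_) hN (fun c => ?_)
    (symmRestrict f hA) (fun c x => symmRestrict_coe_mem_iff f hA (hf _ (r c).2) x)
  · refine disjoint_iff_inf_le.2 ?_
    intro x hx
    have h₁ := (hpre a).subset hx.1
    have h₂ := (hpre b).subset hx.2
    exact hab (h₁.symm.trans h₂)
  · exact ⟨_root_.ConnectedComponents.mk x, (hpre _).symm.subset rfl⟩
  · change IsPreconnected (Subtype.val ⁻¹' connectedComponentIn A (r c) : Set A)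
    rw [hpre c, ← hr c, connectedComponents_preimage_singleton]
    exact isPreconnected_connectedComponent

end VSheaf

end

theorem mainTheorem9 (S : OMinimalStructure) {n : ℕ} (X : Set (Fin n → ℝ))
    [Topology.CWComplex X] (hX : IsDefinableCellularComplex S X)
    (f : X ≃ₜ X) (hf : IsCellularHomeomorph X f)
    {k : ℕ} (P : Fin k → Set (TopCat.of X)) (hP : IsInvariantPartition S X f P) :
    (∀ F : VSheaf (TopCat.of X), VSheaf.IsCConstructible P F →
      VSheaf.RespectsConstantComponents f P F →
        Nonempty ((VSheaf.inverseImage (TopCat.ofHom (f : C(X, X)))).obj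
          ((VSheaf.associated P).obj F) ≅ (VSheaf.associated P).obj F)) ∧
    ((∀ (j : Fin k), ∀ x ∈ P j,
        f '' connectedComponentIn (P j) x = connectedComponentIn (P j) x) →
      Nonempty ((VSheaf.IsCConstructible P).ι ⋙ VSheaf.associated P ⋙
          VSheaf.inverseImage (TopCat.ofHom (f : C(X, X))) ≅
        (VSheaf.IsCConstructible P).ι ⋙ VSheaf.associated P)) := by
  constructor
  · intro F _ hF
    exact ⟨VSheaf.associatedIso (X := TopCat.of X) f P hP.invariant
      fun j => (hF.nonempty_iso_push hP.invariant j).some⟩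
  · intro hc
    have L : ∀ (F : VSheaf (TopCat.of X)) (hF : VSheaf.IsCConstructible P F) (j : Fin k), _ :=
      fun F hF j =>
        haveI : Finite (_root_.ConnectedComponents (P j)) :=
          (hP.incomplete j).finite_connectedComponents hX.finite
        VSheaf.localModel_push_of_connectedComponentIn (X := TopCat.of X) f (hP.invariant j)
          (hc j) F (hF.2 j)
    exact ⟨NatIso.ofComponents
      (fun F => VSheaf.associatedIso (X := TopCat.of X) f P hP.invariant
        fun j => (L F.1 F.2 j).iso)
      -- The parameters are all the global sections, and `u` acts on those of the restriction and of
      -- its direct image by the same map; both compatibilities therefore hold by definition.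
      (fun {F F'} u => VSheaf.associatedIso_hom_naturality (X := TopCat.of X) f P hP.invariant
        _ _ u.1 fun j => VSheaf.LocalModel.iso_hom_naturality (L F.1 F.2 j) (L F'.1 F'.2 j)
          _ _ _ (fun _ => rfl) (fun _ => rfl))⟩
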